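/- An ascent sequence is a sequence $x_1x_2\cdots x_n$ of non-negative integers with $x_1=0$ and $x_i\le \mathrm{asc}(x_1\cdots x_{i-1})+1$ for $1<i\le n$, where $\mathrm{asc}$ denotes the number of ascents, i.e. of places $j$ with $x_j<x_{j+1}$. A sequence avoids $0012$ if it has no subsequence that is order isomorphic to $0012$, i.e. no subsequence $a\,a\,b\,c$ with $a<b<c$. For a sequence $\pi$ let $\mathrm{fwd}(\pi)$ be the length of its maximal final weakly decreasing sequence (its longest weakly decreasing suffix) and $\mathrm{zeros}(\pi)$ its number of $0$'s. For $n\ge 2$ let $\mathcal B_n$ be the (finite) set of ascent sequences of length $n$ that avoid $0012$ and whose last letter is not $0$, and let $$g(x,y;u,v)=\sum_{n\ge 2}\ \sum_{\pi\in\mathcal B_n} x^n\,y^{\mathrm{asc}(\pi)}\,u^{\mathrm{fwd}(\pi)}\,v^{\mathrm{zeros}(\pi)},$$ a formal power series in $x$ whose coefficients are polynomials in $y,u,v$. Theorem. In the field of fractions of $\mathbb Q[y,u][[x]]$, $$g(x,y;u,1)=g(x,y;1,u)=\frac{uxy(1-ux)\kappa-u^2x^2y}{(1-u)(1-ux)+uxy},$$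 where $$\kappa=\kappa(x,y)=\frac{1-x(y+1)-\sqrt{(1-x(y+1))^2-4x^2y}}{2xy}$$ and the square root denotes the formal power series in $x$ with constant term $1$ whose square is $(1-x(y+1))^2-4x^2y$. -/

import Mathlib

namespace AscentSeq

open PowerSeries

/-! ### Ascent sequences, patterns and statistics (a sequence is a list of natural numbers) -/

/-- The number of ascents of a sequence, i.e. of places `j` with `x_j < x_{j+1}`. -/
def asc : List ℕ → ℕ
  | [] => 0
  | [_] => 0
  | a :: b :: l => (if a < b then 1 else 0) + asc (b :: l)

/-- `x_1 x_2 ⋯ x_n` is an ascent sequence: `x_1 = 0`, and `x_i ≤ asc (x_1 ⋯ x_{i-1}) + 1` for all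
`1 < i ≤ n`.  (Positions are counted from `0` in the code.) -/
def IsAscentSeq (x : List ℕ) : Prop :=
  (∀ h : 0 < x.length, x[0] = 0) ∧
    ∀ (i : ℕ) (h : i < x.length), 0 < i → x[i] ≤ asc (x.take i) + 1

/-- Two sequences are order isomorphic: they have equal length and their letters compare in the
same way at any two positions. -/
def OrderIsomorphic (s t : List ℕ) : Prop :=
  ∃ h : s.length = t.length, ∀ (i j : ℕ) (hi : i < s.length) (hj : j < s.length),
    (s[i] < s[j] ↔ t[i] < t[j]) ∧ (s[i] > s[j] ↔ t[i] > t[j])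

/-- `x` contains the pattern `τ`: some subsequence of `x` is order isomorphic to `τ`. -/
def Contains (x τ : List ℕ) : Prop :=
  ∃ s : List ℕ, s.Sublist x ∧ OrderIsomorphic s τ

/-- `x` avoids the pattern `τ`. -/
def Avoids (x τ : List ℕ) : Prop := ¬ Contains x τ

/-- The length of the maximal final weakly decreasing sequence in `x`, i.e. of the longest suffix
of `x` that is weakly decreasing. -/
def fwd : List ℕ → ℕ
  | [] => 0
  | a :: l => if (a :: l).Pairwise (· ≥ ·) then (a :: l).length else fwd l

/-- The number of zeros of `x`. -/
def zeros (x : List ℕ) : ℕ := x.count 0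

/-- The ascent sequences of length `n` that avoid `0012` and have a last letter different from `0`.
(There are none of length `n ≤ 1`.) -/
def B (n : ℕ) : Set (List ℕ) :=
  {x | x.length = n ∧ IsAscentSeq x ∧ Avoids x [0, 0, 1, 2] ∧ ∃ a ∈ x.getLast?, a ≠ 0}

theorem asc_le_length (x : List ℕ) : asc x ≤ x.length := by
  induction x with
  | nil => simp [asc]
  | cons a l ih =>
    cases l with
    | nil => simp [asc]
    | cons b l =>
      simp only [asc, List.length_cons] at ih ⊢
      split <;> omega

theorem finite_B (n : ℕ) : (B n).Finite := by
  refine ((List.finite_length_eq (Fin (n + 2)) n).image (List.map Fin.val)).subset ?_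
  rintro x ⟨hn, ⟨h0, h1⟩, -⟩
  have hb : ∀ a ∈ x, a < n + 2 := by
    intro a ha
    obtain ⟨i, hi, rfl⟩ := List.getElem_of_mem ha
    rcases Nat.eq_zero_or_pos i with rfl | hp
    · rw [h0 hi]; omega
    · have h2 := h1 i hi hp
      have h3 := asc_le_length (x.take i)
      rw [List.length_take] at h3
      omega
  refine ⟨x.pmap (fun a h => (⟨a, h⟩ : Fin (n + 2))) hb, by simpa using hn, ?_⟩
  simp [List.map_pmap]

/-! ### The generating function -/

/-- The polynomial `B_n(y; u, v)`: the sum over the members of `B n` of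
`y ^ (ascents) * u ^ (fwd) * v ^ (zeros)`. -/
noncomputable def Bpoly {R : Type*} [CommSemiring R] (n : ℕ) (y u v : R) : R :=
  ∑ x ∈ (finite_B n).toFinset, y ^ asc x * u ^ fwd x * v ^ zeros x

/-- The generating function `g(x, y; u, v) = ∑ₙ B_n(y; u, v) xⁿ`, a formal power series in `x`,
for arbitrary values `y, u, v` in a commutative semiring (in particular for indeterminates). -/
noncomputable def g {R : Type*} [CommSemiring R] (y u v : R) : R⟦X⟧ :=
  PowerSeries.mk fun n => Bpoly n y u v

/-! ### The closed form -/

/-- The square root of a formal power series `f` with constant coefficient `1`, given by the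
binomial series `(1 + t) ^ (1 / 2)` at `t = f - 1`. -/
noncomputable def psqrt {R : Type*} [CommRing R] [Algebra ℚ R] (f : R⟦X⟧) : R⟦X⟧ :=
  (binomialSeries R (1 / 2 : ℚ)).subst (f - 1)

theorem hasSubst_sub_one {R : Type*} [CommRing R] {f : R⟦X⟧} (hf : constantCoeff f = 1) :
    HasSubst (f - 1) :=
  HasSubst.of_constantCoeff_zero' (by simp [hf])

theorem psqrt_sq {R : Type*} [CommRing R] [Algebra ℚ R] {f : R⟦X⟧} (hf : constantCoeff f = 1) :
    psqrt f ^ 2 = f := by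
  have hs := hasSubst_sub_one hf
  have h1 : binomialSeries R (1 / 2 : ℚ) ^ 2 = 1 + X := by
    rw [pow_two, ← binomialSeries_add]
    have := binomialSeries_nat (R := ℚ) (A := R) 1
    norm_num at this ⊢
    exact this
  rw [psqrt, ← subst_pow hs, h1, ← coe_substAlgHom hs, map_add, map_one, coe_substAlgHom hs,
    subst_X hs]
  ring

theorem constantCoeff_psqrt {R : Type*} [CommRing R] [Algebra ℚ R] {f : R⟦X⟧}
    (hf : constantCoeff f = 1) : constantCoeff (psqrt f) = 1 := by
  rw [← coeff_zero_eq_constantCoeff_apply, psqrt, coeff_subst' (hasSubst_sub_one hf),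
    finsum_eq_single _ 0]
  · simp
  · intro d hd
    simp [hf, hd]

/-- The polynomial ring `ℚ[y, u]`. -/
abbrev Coef : Type := MvPolynomial (Fin 2) ℚ

/-- The indeterminate `y`. -/
noncomputable def yv : Coef := MvPolynomial.X 0

/-- The indeterminate `u`. -/
noncomputable def uv : Coef := MvPolynomial.X 1

/-- The field of fractions of the domain `ℚ[y, u]⟦x⟧` of formal power series in `x`. -/
abbrev L : Type := FractionRing Coef⟦X⟧

/-- The inclusion of `ℚ[y, u]⟦x⟧` in its field of fractions. -/
noncomputable def toL : Coef⟦X⟧ →+* L := algebraMap Coef⟦X⟧ L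

/-- `x` as an element of the field `L`. -/
noncomputable def x : L := toL X

/-- `y` as an element of the field `L`. -/
noncomputable def y : L := toL (C yv)

/-- `u` as an element of the field `L`. -/
noncomputable def u : L := toL (C uv)

/-- The power series `(1 - x (y + 1))² - 4 x² y`; its constant coefficient is `1`. -/
noncomputable def disc : Coef⟦X⟧ :=
  (1 - X * (C yv + 1)) ^ 2 - 4 * X ^ 2 * C yv

theorem constantCoeff_disc : constantCoeff disc = 1 := by
  simp [disc]

/-- `κ = (1 - x (y + 1) - √((1 - x (y + 1))² - 4 x² y)) / (2 x y)`, in the field `L`. -/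
noncomputable def κ : L :=
  (1 - x * (y + 1) - toL (psqrt disc)) / (2 * x * y)

end AscentSeq

namespace AscentSeq

open PowerSeries

/-! Members of `B` are built recursively by their zeros. If the leading 0 is the only zero, removing
it and lowering the other letters by 1 leaves an arbitrary nonempty avoider. If there are at least
two zeros, what follows the last one is weakly decreasing, since otherwise it would complete a
pattern 0 0 b c. Deleting that zero gives a shorter member of `B`, and conversely a 0 may be
inserted before the last j letters for each 1 ≤ j ≤ fwd. The new fwd is j, and one ascent is gained
unless j = fwd. Avoiders in turn are members of `B` followed by zeros, or consist of zeros only.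

Write T for the variable marking fwd. Summing over j gives the functional equation `one_sub_mul_g`,
which involves g(T, v), g(1, v) and the series A(T) of all avoiders, where (1 - xT) A(T) = 1 + g(T,
1).

For v = 1 the kernel is D(T) = (1 - T)(1 - xT) + xyT, with power series root U = 1 + yκ. Setting T =
U determines g(1, 1), hence g(T, 1) (`kernel_mul_g_fwd_X`). For general v the kernel is linear in T,
and its root s determines g(1, v) (`kernel_mul_g_zeros`). Both D(u) g(u, 1) and D(u) g(1, u) come
out as the same expression, and D(u) ≠ 0. -/

/-! ### Ascents, `fwd` and pattern avoidance under concatenation -/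

theorem avoids_iff {x : List ℕ} :
    Avoids x [0, 0, 1, 2] ↔ ∀ a b c, a < b → b < c → ¬ [a, a, b, c].Sublist x := by
  constructor
  · intro h a b c hab hbc hs
    refine h ⟨_, hs, rfl, ?_⟩
    intro i j hi hj
    simp only [List.length_cons, List.length_nil] at hi hj
    interval_cases i <;> interval_cases j <;> simp <;> omega
  · rintro h ⟨s, hs, hl, ho⟩
    match s, hl with
    | [a, a', b, c], _ =>
      have h01 := ho 0 1 (by simp) (by simp)
      have h12 := ho 1 2 (by simp) (by simp)
      have h23 := ho 2 3 (by simp) (by simp)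
      simp at h01 h12 h23
      obtain rfl : a = a' := by omega
      exact h a b c (by omega) (by omega) hs

theorem isAscentSeq_iff {x : List ℕ} :
    IsAscentSeq x ↔ ∀ p a s, x = p ++ a :: s → a ≤ if p = [] then 0 else asc p + 1 := by
  constructor
  · rintro ⟨h0, h1⟩ p a s rfl
    split_ifs with hp
    · subst hp
      simpa using (h0 (by simp)).le
    · simpa using h1 p.length (by simp) (List.length_pos_iff.2 hp)
  · intro h
    refine ⟨fun hx => ?_, fun i hi h0 => ?_⟩
    · match x, hx with
      | a :: s, _ => simpa using h [] a s rfl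
    · have := h (x.take i) x[i] (x.drop (i + 1)) (by simp)
      rwa [if_neg] at this
      rw [List.take_eq_nil_iff]
      rintro (rfl | rfl)
      · exact absurd h0 (lt_irrefl 0)
      · exact absurd hi (by simp)

theorem asc_append_cons_cons (p : List ℕ) (q e : ℕ) (d : List ℕ) :
    asc (p ++ q :: e :: d) = asc (p ++ [q]) + (if q < e then 1 else 0) + asc (e :: d) := by
  induction p with
  | nil => simp [asc]
  | cons a p ih =>
    cases p with
    | nil => simp [asc]; omega
    | cons b p => simp [asc] at ih ⊢; omega

theorem asc_le_append (p q : List ℕ) : asc p ≤ asc (p ++ q) := by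
  rcases p.eq_nil_or_concat with rfl | ⟨p, a, rfl⟩
  · simp [asc]
  · cases q with
    | nil => simp
    | cons e d =>
      rw [List.concat_eq_append, List.append_assoc, List.singleton_append, asc_append_cons_cons]
      omega

theorem asc_append_zero (p : List ℕ) : asc (p ++ [0]) = asc p := by
  rcases p.eq_nil_or_concat with rfl | ⟨p, a, rfl⟩
  · simp [asc]
  · rw [List.concat_eq_append, List.append_assoc, List.singleton_append, asc_append_cons_cons]
    simp [asc]

theorem fwd_le_length (x : List ℕ) : fwd x ≤ x.length := by
  induction x with
  | nil => simp [fwd]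
  | cons a l ih => simp only [fwd]; split <;> simp; omega

/-- This is the working characterization of `fwd`: suffixes of weakly decreasing lists are weakly
decreasing, so comparing a length with `fwd` tests a single suffix. -/
theorem length_le_fwd_iff (p d : List ℕ) :
    d.length ≤ fwd (p ++ d) ↔ d.Pairwise (· ≥ ·) := by
  induction p with
  | nil =>
    cases d with
    | nil => simp [fwd]
    | cons a l =>
      have := fwd_le_length l
      simp only [List.nil_append, fwd]
      split_ifs with h
      · simp [h]
      · simp only [h, List.length_cons, iff_false]; omega
  | cons a p ih =>
    rw [List.cons_append, fwd]
    split_ifs with h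
    · have : d.Pairwise (· ≥ ·) := h.sublist ((List.sublist_append_right p d).cons a)
      simp only [this, iff_true, List.length_cons, List.length_append]
      omega
    · exact ih

theorem fwd_pos {x : List ℕ} (hx : x ≠ []) : 0 < fwd x := by
  rcases x.eq_nil_or_concat with rfl | ⟨p, a, rfl⟩
  · exact absurd rfl hx
  · have := (length_le_fwd_iff p [a]).2 (by simp)
    simpa [Nat.succ_le_iff] using this

theorem fwd_append_of_lt {p : List ℕ} {q e : ℕ} {d : List ℕ} (hd : (e :: d).Pairwise (· ≥ ·))
    (hq : q < e) : fwd (p ++ q :: e :: d) = d.length + 1 := by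
  have h1 := (length_le_fwd_iff (p ++ [q]) (e :: d)).2 hd
  have h2 := (length_le_fwd_iff p (q :: e :: d)).not.2 (by
    intro h
    have := (List.pairwise_cons.1 h).1 e (by simp)
    omega)
  simp at h1 h2
  omega

theorem fwd_append_zero (p : List ℕ) : fwd (p ++ [0]) = fwd p + 1 := by
  induction p with
  | nil => simp [fwd]
  | cons a p ih =>
    have : (a :: (p ++ [0])).Pairwise (· ≥ ·) ↔ (a :: p).Pairwise (· ≥ ·) := by
      rw [← List.cons_append, List.pairwise_append]
      simp
    simp only [List.cons_append, fwd, this, ih]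
    split <;> simp

/-- The first letter of `d` is its largest, so its bound covers all of `d`. The condition sees only
`asc p`, which a 0 appended to `p` does not change. -/
theorem isAscentSeq_append_iff {p d : List ℕ} (hp : p ≠ []) (hd : d.Pairwise (· ≥ ·)) :
    IsAscentSeq (p ++ d) ↔ IsAscentSeq p ∧ ∀ a ∈ d, a ≤ asc p + 1 := by
  constructor
  · intro h
    rw [isAscentSeq_iff] at h
    refine ⟨isAscentSeq_iff.2 fun p' a s hs => h p' a (s ++ d) (by simp [hs]), ?_⟩
    cases d with
    | nil => simp
    | cons e d =>
      have he := h p e d rfl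
      rw [if_neg hp] at he
      intro a ha
      rcases List.mem_cons.1 ha with rfl | ha
      · exact he
      · exact ((List.pairwise_cons.1 hd).1 a ha).trans he
  · rintro ⟨h1, h2⟩
    rw [isAscentSeq_iff] at h1 ⊢
    intro p' a s hs
    rcases List.append_eq_append_iff.1 hs with ⟨t, rfl, rfl⟩ | ⟨t, rfl, ht⟩
    · have := h2 a (by simp)
      have := asc_le_append p t
      rw [if_neg (by simp [hp])]
      omega
    · cases t with
      | nil =>
        simp only [List.append_nil] at hp h2 ⊢
        rw [if_neg hp]
        exact h2 a (by rw [← show a :: s = d by simpa using ht]; simp)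
      | cons b t =>
        obtain ⟨rfl, rfl⟩ := List.cons.inj ht
        exact h1 _ _ _ rfl

theorem isAscentSeq_append_zero_iff {p : List ℕ} :
    IsAscentSeq (p ++ [0]) ↔ IsAscentSeq p := by
  by_cases hp : p = []
  · subst hp
    simp [IsAscentSeq]
  · simp [isAscentSeq_append_iff hp]

/-- The inserted 0 cannot play b or c, which are positive. If it played an a, then b < c would both
lie in the weakly decreasing `d`. -/
theorem avoids_append_zero_append_iff {p d : List ℕ} (hd : d.Pairwise (· ≥ ·)) :
    Avoids (p ++ 0 :: d) [0, 0, 1, 2] ↔ Avoids (p ++ d) [0, 0, 1, 2] := by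
  simp only [avoids_iff]
  refine ⟨fun h a b c hab hbc hs => h a b c hab hbc (hs.trans ?_),
    fun h a b c hab hbc hs => h a b c hab hbc ?_⟩
  · exact (List.sublist_cons_self 0 d).append_left p
  · obtain ⟨l₁, l₂, hl, h1, h2⟩ := List.sublist_append_iff.1 hs
    rw [hl]
    refine h1.append ?_
    have key : ¬ [b, c].Sublist l₂ := by
      intro h3
      have h4 := h3.trans h2
      rw [List.sublist_cons_iff] at h4
      rcases h4 with h4 | ⟨r, hr, -⟩
      · have := hd.sublist h4
        simp at this
        omega
      · simp at hr
        omega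
    rw [List.sublist_cons_iff] at h2
    rcases h2 with h2 | ⟨r, rfl, h2⟩
    · exact h2
    · exfalso
      match l₁, hl with
      | [], hl => simp at hl; apply key; simp [hl.1, ← hl.2]
      | [_], hl => simp at hl; apply key; simp [← hl.2.2]
      | [_, _], hl => simp at hl; omega
      | [_, _, _], hl => simp at hl; omega
      | _ :: _ :: _ :: _ :: _, hl => simp at hl

/-- The `0012`-avoiding ascent sequences of length `n`. -/
def avoiders (n : ℕ) : Set (List ℕ) :=
  {x | x.length = n ∧ IsAscentSeq x ∧ Avoids x [0, 0, 1, 2]}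

theorem append_zero_mem_avoiders {n : ℕ} {z : List ℕ} :
    z ++ [0] ∈ avoiders (n + 1) ↔ z ∈ avoiders n := by
  have := avoids_append_zero_append_iff (p := z) (d := []) (by simp)
  simp only [List.append_nil] at this
  simp [avoiders, isAscentSeq_append_zero_iff, this]

/-! ### Sequences with a single zero -/

theorem asc_map_succ (z : List ℕ) : asc (z.map Nat.succ) = asc z := by
  induction z with
  | nil => rfl
  | cons a z ih =>
    cases z with
    | nil => rfl
    | cons b z => simpa [asc] using ih

theorem fwd_map_succ (z : List ℕ) : fwd (z.map Nat.succ) = fwd z := by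
  induction z with
  | nil => rfl
  | cons a z ih =>
    have : ((a :: z).map Nat.succ).Pairwise (· ≥ ·) ↔ (a :: z).Pairwise (· ≥ ·) := by
      rw [List.pairwise_map]; simp
    simp only [List.map_cons] at this
    simp only [List.map_cons, fwd, this, ih]
    simp

theorem asc_zero_cons_map_succ {z : List ℕ} (hz : z ≠ []) :
    asc (0 :: z.map Nat.succ) = asc z + 1 := by
  cases z with
  | nil => exact absurd rfl hz
  | cons a z => rw [← asc_map_succ (a :: z)]; simp [asc]; omega

theorem fwd_zero_cons_map_succ {z : List ℕ} (hz : z ≠ []) :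
    fwd (0 :: z.map Nat.succ) = fwd z := by
  rw [← fwd_map_succ z, fwd, if_neg]
  cases z with
  | nil => exact absurd rfl hz
  | cons a z => simp

theorem zeros_zero_cons_map_succ (z : List ℕ) : zeros (0 :: z.map Nat.succ) = 1 := by
  simp [zeros, List.count_eq_zero]

/-- The leading 0 creates one extra ascent, which raises each bound by exactly the amount of the
shift. -/
theorem isAscentSeq_zero_cons_map_succ {z : List ℕ} :
    IsAscentSeq (0 :: z.map Nat.succ) ↔ IsAscentSeq z := by
  simp only [isAscentSeq_iff]
  constructor
  · rintro h p a s rfl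
    have := h (0 :: p.map Nat.succ) (a + 1) (s.map Nat.succ) (by simp)
    simp only [reduceCtorEq, if_false] at this
    split_ifs with hp
    · subst hp; simpa [asc] using this
    · rw [asc_zero_cons_map_succ hp] at this; omega
  · intro h p a s hs
    cases p with
    | nil => simp at hs; simp [hs.1]
    | cons b p =>
      simp only [List.cons_append, List.cons.injEq, List.map_eq_append_iff, List.map_eq_cons_iff]
        at hs
      obtain ⟨rfl, l₁, l₂, rfl, rfl, a', s', rfl, rfl, rfl⟩ := hs
      have := h l₁ a' s' rfl
      simp only [reduceCtorEq, if_false]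
      split_ifs at this with hp
      · subst hp; simp [asc]; omega
      · rw [asc_zero_cons_map_succ hp]; omega

/-- The only 0 cannot be the repeated letter a, nor the larger b or c, so every occurrence of the
pattern lies in the shifted part. -/
theorem avoids_zero_cons_map_succ {z : List ℕ} :
    Avoids (0 :: z.map Nat.succ) [0, 0, 1, 2] ↔ Avoids z [0, 0, 1, 2] := by
  simp only [avoids_iff]
  constructor
  · intro h a b c hab hbc hs
    exact h (a + 1) (b + 1) (c + 1) (by omega) (by omega) ((hs.map Nat.succ).cons 0)
  · intro h a b c hab hbc hs
    have h0 : a ≠ 0 := by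
      rintro rfl
      have := hs.count_le 0
      rw [show List.count 0 (0 :: z.map Nat.succ) = 1 from zeros_zero_cons_map_succ z] at this
      simp at this
    rw [List.sublist_cons_iff] at hs
    rcases hs with hs | ⟨r, hr, -⟩
    · have := hs.map Nat.pred
      rw [List.map_map] at this
      refine h (a - 1) (b - 1) (c - 1) (by omega) (by omega) ?_
      simpa [Function.comp_def] using this
    · simp at hr; omega

theorem zero_cons_map_succ_mem_B {n : ℕ} {z : List ℕ} :
    0 :: z.map Nat.succ ∈ B (n + 2) ↔ z ∈ avoiders (n + 1) := by
  simp only [B, avoiders, Set.mem_ofPred_eq, isAscentSeq_zero_cons_map_succ,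
    avoids_zero_cons_map_succ, List.length_cons, List.length_map]
  constructor
  · rintro ⟨h1, h2, h3, -⟩
    exact ⟨by omega, h2, h3⟩
  · rintro ⟨h1, h2, h3⟩
    refine ⟨by omega, h2, h3, ?_⟩
    rcases z.eq_nil_or_concat with rfl | ⟨p, a, rfl⟩
    · simp at h1
    · refine ⟨a + 1, ?_, by simp⟩
      rw [List.concat_eq_append, List.map_append, ← List.cons_append, List.map_singleton,
        List.getLast?_concat]
      rfl

theorem exists_map_succ_of_zeros_eq_one {n : ℕ} {x : List ℕ} (hx : x ∈ B n) (h1 : zeros x = 1) :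
    ∃ z : List ℕ, 0 :: z.map Nat.succ = x := by
  obtain ⟨-, ⟨h0, -⟩, -⟩ := hx
  cases x with
  | nil => simp [zeros] at h1
  | cons a t =>
    obtain rfl : a = 0 := h0 (by simp)
    have ht : 0 ∉ t := by simpa [zeros, List.count_eq_zero] using h1
    refine ⟨t.map Nat.pred, ?_⟩
    rw [List.map_map]
    congr 1
    conv_rhs => rw [← List.map_id t]
    refine List.map_congr_left fun b hb => ?_
    have : b ≠ 0 := fun h => ht (h ▸ hb)
    simp; omega

/-! ### Inserting a zero into the final decreasing run -/

theorem exists_getLast?_append {p d : List ℕ} (hd : d ≠ []) (P : ℕ → Prop) :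
    (∃ a ∈ (p ++ d).getLast?, P a) ↔ ∃ a ∈ d.getLast?, P a := by
  rw [List.getLast?_append_of_ne_nil p hd]

theorem insert_zero_mem_B {n : ℕ} {p d : List ℕ} (hp : p ≠ []) (hd : d ≠ [])
    (hd' : d.Pairwise (· ≥ ·)) : p ++ 0 :: d ∈ B (n + 1) ↔ p ++ d ∈ B n := by
  have h1 : IsAscentSeq (p ++ 0 :: d) ↔ IsAscentSeq (p ++ d) := by
    rw [isAscentSeq_append_iff hp hd', List.append_cons, isAscentSeq_append_iff (by simp) hd',
      isAscentSeq_append_zero_iff, asc_append_zero]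
  have h2 : (0 :: d).getLast? = d.getLast? := by
    cases d with
    | nil => exact absurd rfl hd
    | cons e d => simp
  simp only [B, Set.mem_ofPred_eq, h1, avoids_append_zero_append_iff hd', List.length_append,
    List.length_cons, exists_getLast?_append hd, exists_getLast?_append (List.cons_ne_nil 0 d), h2]
  rw [← Nat.add_assoc, Nat.add_right_cancel_iff]

/-- Let q and e be the letters around the insertion point. The step from 0 to e is an ascent and the
step from q to 0 is not. Hence an ascent is gained exactly when q ≥ e, that is, when the decreasing
run extends beyond `d`. -/
theorem asc_insert_zero {p d : List ℕ} (hp : p ≠ []) (hd : d ≠ [])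
    (hd' : d.Pairwise (· ≥ ·)) (h0 : 0 ∉ d) :
    asc (p ++ 0 :: d) = asc (p ++ d) + if d.length < fwd (p ++ d) then 1 else 0 := by
  rcases p.eq_nil_or_concat with rfl | ⟨p, q, rfl⟩
  · exact absurd rfl hp
  cases d with
  | nil => exact absurd rfl hd
  | cons e d =>
    have he : 0 < e := Nat.pos_of_ne_zero fun h => h0 (by simp [h])
    have h1 := length_le_fwd_iff p (q :: e :: d)
    have h2 : (q :: e :: d).Pairwise (· ≥ ·) ↔ e ≤ q := by
      refine ⟨fun h => (List.pairwise_cons.1 h).1 e (by simp), fun h => List.pairwise_cons.2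
        ⟨fun a ha => ?_, hd'⟩⟩
      rcases List.mem_cons.1 ha with rfl | ha
      · exact h
      · exact ((List.pairwise_cons.1 hd').1 a ha).trans h
    rw [h2] at h1
    simp only [List.concat_eq_append, List.append_assoc, List.singleton_append,
      asc_append_cons_cons]
    simp only [List.length_cons] at h1 ⊢
    have h3 : asc (0 :: e :: d) = asc (e :: d) + 1 := by simp [asc, he]; omega
    rw [h3]
    simp only [Nat.succ_le_iff] at h1
    simp only [h1, Nat.not_lt_zero, if_false]
    split_ifs <;> omega

theorem fwd_insert_zero {p d : List ℕ} (hd : d ≠ [])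
    (hd' : d.Pairwise (· ≥ ·)) (h0 : 0 ∉ d) : fwd (p ++ 0 :: d) = d.length := by
  cases d with
  | nil => exact absurd rfl hd
  | cons e d => exact fwd_append_of_lt hd' (Nat.pos_of_ne_zero fun h => h0 (by simp [h]))

theorem zeros_insert_zero (p d : List ℕ) : zeros (p ++ 0 :: d) = zeros (p ++ d) + 1 := by
  simp [zeros]; omega

/-! ### Decompositions and recurrences for the polynomials -/

theorem finite_avoiders (n : ℕ) : (avoiders n).Finite := by
  refine (Set.Finite.preimage (f := fun z : List ℕ => 0 :: z.map Nat.succ) ?_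
    (finite_B (n + 1))).union (Set.finite_singleton []) |>.subset ?_
  · intro z _ z' _ h
    exact List.map_injective_iff.2 Nat.succ_injective (List.cons.inj h).2
  · intro z hz
    cases n with
    | zero => exact Or.inr (List.length_eq_zero_iff.1 hz.1)
    | succ n => exact Or.inl (zero_cons_map_succ_mem_B.2 hz)

/-- The sum of `y ^ (ascents) * u ^ (fwd)` over the `0012`-avoiding ascent sequences of
length `n`. -/
noncomputable def avoidersPoly {R : Type*} [CommSemiring R] (n : ℕ) (y u : R) : R :=
  ∑ x ∈ (finite_avoiders n).toFinset, y ^ asc x * u ^ fwd x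

theorem B_eq_empty_of_le_one {n : ℕ} (hn : n ≤ 1) : B n = ∅ := by
  refine Set.eq_empty_of_forall_notMem ?_
  rintro x ⟨h1, h2, -, a, ha, h0⟩
  match x, h1 with
  | [], _ => simp at ha
  | [b], _ =>
    have := h2.1 (by simp)
    simp at ha this
    omega
  | _ :: _ :: _, h1 => simp at h1; omega

theorem Bpoly_of_le_one {R : Type*} [CommSemiring R] {n : ℕ} (hn : n ≤ 1) (y u v : R) :
    Bpoly n y u v = 0 := by
  simp [Bpoly, B_eq_empty_of_le_one hn]

theorem avoidersPoly_zero {R : Type*} [CommSemiring R] (y u : R) : avoidersPoly 0 y u = 1 := by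
  have : (finite_avoiders 0).toFinset = {[]} := by
    ext x
    simp only [Set.Finite.mem_toFinset, Finset.mem_singleton]
    constructor
    · rintro ⟨h, -⟩
      exact List.length_eq_zero_iff.1 h
    · rintro rfl
      exact ⟨rfl, by simp [IsAscentSeq], by simp [avoids_iff]⟩
  simp [avoidersPoly, this, asc, fwd]

/-- Split by the last letter: removing a final 0 keeps the ascents and lowers `fwd` by 1. -/
theorem avoidersPoly_succ {R : Type*} [CommSemiring R] (n : ℕ) (y u : R) :
    avoidersPoly (n + 1) y u = Bpoly (n + 1) y u 1 + u * avoidersPoly n y u := by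
  rw [avoidersPoly, ← Finset.sum_filter_add_sum_filter_not _
    (fun x => ∃ a ∈ x.getLast?, a ≠ 0)]
  congr 1
  · rw [Bpoly]
    refine Finset.sum_congr ?_ (by simp)
    ext x
    simp [avoiders, B, and_assoc]
  · rw [avoidersPoly, Finset.mul_sum]
    symm
    refine Finset.sum_bij (fun z _ => z ++ [0]) ?_ ?_ ?_ ?_
    · intro z hz
      simpa [append_zero_mem_avoiders] using hz
    · intro z _ z' _ h
      exact List.append_cancel_right h
    · intro x hx
      simp only [Finset.mem_filter, Set.Finite.mem_toFinset] at hx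
      obtain ⟨hx, h0⟩ := hx
      rcases x.eq_nil_or_concat with rfl | ⟨p, a, rfl⟩
      · exact absurd hx.1 (by simp)
      · obtain rfl : a = 0 := by simpa using h0
        rw [List.concat_eq_append] at hx ⊢
        exact ⟨p, by simpa [append_zero_mem_avoiders] using hx, rfl⟩
    · intro z _
      rw [fwd_append_zero, asc_append_zero]
      ring

theorem exists_append_of_le_fwd {n j : ℕ} {x : List ℕ} (hx : x ∈ B n) (h1 : 1 ≤ j)
    (h2 : j ≤ fwd x) : ∃ p d : List ℕ, x = p ++ d ∧ d.length = j ∧ p ≠ [] ∧ d ≠ [] ∧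
      d.Pairwise (· ≥ ·) ∧ 0 ∉ d := by
  have hl := fwd_le_length x
  obtain ⟨p, d, rfl, hd⟩ : ∃ p d : List ℕ, x = p ++ d ∧ d.length = j :=
    ⟨x.take (x.length - j), x.drop (x.length - j), by simp, by simp; omega⟩
  have hd0 : d ≠ [] := by rintro rfl; simp at hd; omega
  have hd' := (length_le_fwd_iff p d).1 (hd.trans_le h2)
  obtain ⟨-, hA, -, hlast⟩ := hx
  have h0 : 0 ∉ d := by
    rw [exists_getLast?_append hd0] at hlast
    rcases d.eq_nil_or_concat with rfl | ⟨d, a, rfl⟩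
    · exact absurd rfl hd0
    · rw [List.concat_eq_append] at hlast hd' ⊢
      rw [List.pairwise_append] at hd'
      simp at hlast hd' ⊢
      refine ⟨fun h => ?_, Ne.symm hlast⟩
      have := hd'.2 0 h
      omega
  refine ⟨p, d, rfl, hd, ?_, hd0, hd', h0⟩
  rintro rfl
  cases d with
  | nil => exact hd0 rfl
  | cons e d =>
    have := hA.1 (by simp)
    simp at this
    simp [this] at h0

/-- Cut at the last zero. An earlier zero together with this one and an increase b < c to its right
would form 0012. -/
theorem exists_append_zero_of_one_lt_zeros {n : ℕ} {x : List ℕ} (hx : x ∈ B n)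
    (h : 1 < zeros x) : ∃ p d : List ℕ, x = p ++ 0 :: d ∧ p ≠ [] ∧ d ≠ [] ∧
      d.Pairwise (· ≥ ·) ∧ 0 ∉ d := by
  obtain ⟨-, hA, hav, hlast⟩ := hx
  have hmem : 0 ∈ x.reverse := by
    rw [List.mem_reverse, ← List.count_pos_iff]
    exact lt_trans zero_lt_one h
  obtain ⟨d, p, hd, h0⟩ := List.eq_append_cons_of_mem hmem
  obtain rfl : x = p.reverse ++ 0 :: d.reverse := by
    rw [← List.reverse_reverse x, hd]; simp
  have hc : 0 ∈ p.reverse := by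
    rw [← List.count_pos_iff]
    have : List.count 0 d.reverse = 0 := by simpa [List.count_eq_zero] using h0
    simp only [zeros, List.count_append, List.count_cons_self, this] at h
    omega
  refine ⟨_, _, rfl, List.ne_nil_of_mem hc, ?_, ?_, by simpa using h0⟩
  · intro hnil
    simp [hnil] at hlast
  · rw [List.pairwise_iff_forall_sublist]
    intro b c hbc
    by_contra! hlt
    have hb : b ∈ d.reverse := hbc.subset (by simp)
    refine avoids_iff.1 hav 0 b c (Nat.pos_of_ne_zero ?_) hlt ?_
    · rintro rfl
      exact h0 (by simpa using hb)
    · exact (List.singleton_sublist.2 hc).append (hbc.cons_cons 0)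

theorem zeros_pos {n : ℕ} {x : List ℕ} (hx : x ∈ B n) : 0 < zeros x := by
  obtain ⟨-, hA, -, hlast⟩ := hx
  cases x with
  | nil => simp at hlast
  | cons a t =>
    obtain rfl : a = 0 := hA.1 (by simp)
    simp [zeros]

/-- The first term counts the sequences with a single zero. In the double sum, `x` is the sequence
after deletion of the last zero and `j` the number of letters that followed this zero. -/
theorem Bpoly_add_two {R : Type*} [CommSemiring R] (n : ℕ) (y u v : R) :
    Bpoly (n + 2) y u v = v * y * avoidersPoly (n + 1) y u +
      ∑ x ∈ (finite_B (n + 1)).toFinset, ∑ j ∈ Finset.Icc 1 (fwd x),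
        y ^ (asc x + if j < fwd x then 1 else 0) * u ^ j * v ^ (zeros x + 1) := by
  rw [Bpoly, ← Finset.sum_filter_add_sum_filter_not _ (fun x => zeros x = 1)]
  congr 1
  · rw [avoidersPoly, Finset.mul_sum]
    symm
    refine Finset.sum_bij (fun z _ => 0 :: z.map Nat.succ) ?_ ?_ ?_ ?_
    · intro z hz
      simp only [Set.Finite.mem_toFinset, Finset.mem_filter] at hz ⊢
      exact ⟨zero_cons_map_succ_mem_B.2 hz, zeros_zero_cons_map_succ z⟩
    · intro z _ z' _ h
      exact List.map_injective_iff.2 Nat.succ_injective (List.cons.inj h).2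
    · intro x hx
      simp only [Set.Finite.mem_toFinset, Finset.mem_filter] at hx
      obtain ⟨z, rfl⟩ := exists_map_succ_of_zeros_eq_one hx.1 hx.2
      exact ⟨z, by simpa using zero_cons_map_succ_mem_B.1 hx.1, rfl⟩
    · intro z hz
      have hz0 : z ≠ [] := by
        rintro rfl
        simp [avoiders] at hz
      rw [asc_zero_cons_map_succ hz0, fwd_zero_cons_map_succ hz0, zeros_zero_cons_map_succ]
      ring
  · rw [Finset.sum_sigma']
    symm
    refine Finset.sum_bij (fun s _ => s.1.take (s.1.length - s.2) ++
      0 :: s.1.drop (s.1.length - s.2)) ?_ ?_ ?_ ?_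
    · rintro ⟨x, j⟩ h
      simp only [Finset.mem_sigma, Set.Finite.mem_toFinset, Finset.mem_Icc] at h
      obtain ⟨hx, h1, h2⟩ := h
      obtain ⟨p, d, rfl, rfl, hp, hd, hd', h0⟩ := exists_append_of_le_fwd hx h1 h2
      simp only [List.length_append, Nat.add_sub_cancel, List.take_left, List.drop_left,
        Finset.mem_filter, Set.Finite.mem_toFinset, zeros_insert_zero]
      have := zeros_pos hx
      exact ⟨(insert_zero_mem_B hp hd hd').2 hx, by omega⟩
    · rintro ⟨x, j⟩ h ⟨x', j'⟩ h' heq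
      simp only [Finset.mem_sigma, Set.Finite.mem_toFinset, Finset.mem_Icc] at h h'
      obtain ⟨hx, h1, h2⟩ := h
      obtain ⟨hx', h1', h2'⟩ := h'
      obtain ⟨p, d, rfl, rfl, hp, hd, hd', h0⟩ := exists_append_of_le_fwd hx h1 h2
      obtain ⟨q, e, rfl, rfl, hq, he, he', h0'⟩ := exists_append_of_le_fwd hx' h1' h2'
      simp only [List.length_append, Nat.add_sub_cancel, List.take_left, List.drop_left] at heq
      -- The insertion point is recovered from the image, whose `fwd` is the number of letters after
      -- the inserted zero.
      have hl : d.length = e.length := by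
        rw [← fwd_insert_zero (p := p) hd hd' h0, heq, fwd_insert_zero he he' h0']
      obtain ⟨rfl, hde⟩ := List.append_inj' heq (by simp [hl])
      obtain rfl := (List.cons.inj hde).2
      rfl
    · intro x hx
      simp only [Set.Finite.mem_toFinset, Finset.mem_filter] at hx
      obtain ⟨hx, h1⟩ := hx
      have := zeros_pos hx
      obtain ⟨p, d, rfl, hp, hd, hd', h0⟩ := exists_append_zero_of_one_lt_zeros hx (by omega)
      refine ⟨⟨p ++ d, d.length⟩, ?_, by simp⟩
      simp only [Finset.mem_sigma, Set.Finite.mem_toFinset, Finset.mem_Icc]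
      exact ⟨(insert_zero_mem_B hp hd hd').1 hx, List.length_pos_iff.2 hd,
        (length_le_fwd_iff p d).2 hd'⟩
    · rintro ⟨x, j⟩ h
      simp only [Finset.mem_sigma, Set.Finite.mem_toFinset, Finset.mem_Icc] at h
      obtain ⟨hx, h1, h2⟩ := h
      obtain ⟨p, d, rfl, rfl, hp, hd, hd', h0⟩ := exists_append_of_le_fwd hx h1 h2
      simp only [List.length_append, Nat.add_sub_cancel, List.take_left, List.drop_left,
        zeros_insert_zero, asc_insert_zero hp hd hd' h0, fwd_insert_zero hd hd' h0]

theorem sum_Icc_pow_mul_ite {R : Type*} [CommRing R] {f : ℕ} (hf : 0 < f) (y u : R) :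
    (1 - u) * ∑ j ∈ Finset.Icc 1 f, y ^ (if j < f then 1 else 0) * u ^ j =
      (1 - u) * u ^ f + y * (u - u ^ f) := by
  obtain ⟨k, rfl⟩ : ∃ k, f = k + 1 := ⟨f - 1, by omega⟩
  rw [Finset.sum_Icc_succ_top (by omega)]
  have h1 : ∑ j ∈ Finset.Icc 1 k, y ^ (if j < k + 1 then 1 else 0) * u ^ j =
      y * ∑ j ∈ Finset.Icc 1 k, u ^ j := by
    rw [Finset.mul_sum]
    refine Finset.sum_congr rfl fun j hj => ?_
    rw [if_pos (by simp at hj; omega), pow_one]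
  have h2 : (1 - u) * ∑ j ∈ Finset.Icc 1 k, u ^ j = u - u ^ (k + 1) := by
    clear h1 hf
    induction k with
    | zero => simp
    | succ k ih => rw [Finset.sum_Icc_succ_top (by omega), mul_add, ih]; ring
  rw [h1, if_neg (lt_irrefl _), pow_zero, one_mul, mul_add, ← h2]
  ring

theorem one_sub_mul_Bpoly_add_two {R : Type*} [CommRing R] (n : ℕ) (y u v : R) :
    (1 - u) * Bpoly (n + 2) y u v = (1 - u) * v * y * avoidersPoly (n + 1) y u +
      v * ((1 - u) * Bpoly (n + 1) y u v +
        y * (u * Bpoly (n + 1) y 1 v - Bpoly (n + 1) y u v)) := by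
  rw [Bpoly_add_two, mul_add, ← mul_assoc, ← mul_assoc]
  congr 1
  simp only [Bpoly, Finset.mul_sum, ← Finset.sum_sub_distrib, ← Finset.sum_add_distrib]
  refine Finset.sum_congr rfl fun x hx => ?_
  have hne : x ≠ [] := by
    rintro rfl
    have := zeros_pos ((finite_B _).mem_toFinset.1 hx)
    simp [zeros] at this
  have key := sum_Icc_pow_mul_ite (fwd_pos hne) y u
  rw [Finset.mul_sum] at key
  have : ∀ j, (1 - u) * (y ^ (asc x + if j < fwd x then 1 else 0) * u ^ j * v ^ (zeros x + 1)) =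
      y ^ asc x * v ^ (zeros x + 1) * ((1 - u) * (y ^ (if j < fwd x then 1 else 0) * u ^ j)) :=
    fun j => by ring
  simp only [this, ← Finset.mul_sum] at key ⊢
  rw [key]
  ring

/-! ### Functional equations for the power series -/

/-- The generating function of the `0012`-avoiding ascent sequences with respect to length,
ascents and `fwd`. -/
noncomputable def avoidersSeries {R : Type*} [CommSemiring R] (y u : R) : R⟦X⟧ :=
  PowerSeries.mk fun n => avoidersPoly n y u

theorem one_sub_mul_avoidersSeries {R : Type*} [CommRing R] (y u : R) :
    (1 - X * C u) * avoidersSeries y u = 1 + g y u 1 := by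
  ext n
  rw [sub_mul, one_mul, mul_assoc]
  cases n with
  | zero => simp [avoidersSeries, g, avoidersPoly_zero, Bpoly_of_le_one]
  | succ n =>
    simp [avoidersSeries, g, coeff_succ_X_mul, avoidersPoly_succ, coeff_one]

/-- The factor 1 - u clears the geometric sums over j. The 1 subtracted from `avoidersSeries`
removes the empty sequence. -/
theorem one_sub_mul_g {R : Type*} [CommRing R] (y u v : R) :
    (1 - C u) * g y u v = (1 - C u) * X * C v * C y * (avoidersSeries y u - 1) +
      X * C v * ((1 - C u) * g y u v + C y * (C u * g y 1 v - g y u v)) := by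
  obtain ⟨w, hw⟩ : ∃ w, w = 1 - u := ⟨_, rfl⟩
  have h1 : (1 : R⟦X⟧) - C u = C w := by simp [hw]
  have h2 : C w * X * C v * C y * (avoidersSeries y u - 1) +
      X * C v * (C w * g y u v + C y * (C u * g y 1 v - g y u v)) =
      X * (C w * (C v * (C y * (avoidersSeries y u - 1))) +
        C v * (C w * g y u v + C y * (C u * g y 1 v - g y u v))) := by
    ring
  rw [h1, h2]
  ext n
  rcases n with _ | _ | n
  · simp [g, Bpoly_of_le_one]
  · rw [coeff_succ_X_mul]
    simp [g, avoidersSeries, Bpoly_of_le_one, avoidersPoly_zero]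
  · have := one_sub_mul_Bpoly_add_two n y u v
    rw [← hw] at this
    rw [coeff_succ_X_mul]
    simpa [g, avoidersSeries, coeff_one, mul_assoc] using this

theorem map_g {R S : Type*} [CommSemiring R] [CommSemiring S] (φ : R →+* S) (y u v : R) :
    PowerSeries.map φ (g y u v) = g (φ y) (φ u) (φ v) := by
  ext n
  simp [g, Bpoly]

/-! ### The kernel method -/

theorem ne_zero_of_constantCoeff_eq_one {R : Type*} [CommRing R] [Nontrivial R] {f : R⟦X⟧}
    (hf : constantCoeff f = 1) : f ≠ 0 := by
  rintro rfl
  simp at hf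

/-- The vanishing principle behind the kernel method: a power series with coefficients free of the
catalytic variable that is divisible by `T - s`, where `s` has constant coefficient `1`, is zero. -/
theorem eq_zero_of_sub_mul_eq {R : Type*} [CommRing R] {s r : R⟦X⟧} {f : (Polynomial R)⟦X⟧}
    (hs : constantCoeff s = 1)
    (h : (C Polynomial.X - PowerSeries.map Polynomial.C s) * f = PowerSeries.map Polynomial.C r) :
    r = 0 := by
  -- Once the lower coefficients of `f` vanish, only the constant term 1 of `s` contributes. Setting
  -- the catalytic variable to 1 then kills the coefficient of `r`, and the monic factor forces that
  -- of `f` to vanish.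
  have key : ∀ n, (∀ m < n, coeff m f = 0) →
      (Polynomial.X - Polynomial.C 1) * coeff n f = Polynomial.C (coeff n r) := by
    intro n ih
    have h1 := congrArg (coeff n) h
    rw [sub_mul, map_sub, coeff_C_mul, coeff_map, coeff_mul,
      Finset.sum_eq_single (0, n)] at h1
    · rw [← h1]
      simp [hs, sub_mul]
    · rintro ⟨i, j⟩ hij hne
      rw [Finset.HasAntidiagonal.mem_antidiagonal] at hij
      have : j < n := by
        rcases Nat.eq_zero_or_pos i with rfl | hi
        · simp at hij hne
          omega
        · simp at hij
          omega
      rw [ih j this, mul_zero]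
    · intro h0
      simp at h0
  have hf : ∀ n, coeff n f = 0 := by
    intro n
    induction n using Nat.strong_induction_on with
    | _ n ih =>
      have h1 := key n ih
      have h2 : coeff n r = 0 := by
        have := congrArg (Polynomial.eval 1) h1
        simpa using this.symm
      rw [h2, map_zero] at h1
      exact ((Polynomial.monic_X_sub_C (1 : R)).mul_right_eq_zero_iff).1 h1
  ext n
  have h1 := key n fun m _ => hf m
  rw [hf n, mul_zero] at h1
  simpa using h1.symm

/-- The functional equation of `g(x, y; T, 1)`, cleared of denominators. -/
theorem kernel_equation {R : Type*} [CommRing R] (y : R) :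
    (1 - X) * ((1 - C Polynomial.X) * (1 - X * C Polynomial.X) +
        X * C (Polynomial.C y) * C Polynomial.X) * g (Polynomial.C y) Polynomial.X 1 =
      X * C (Polynomial.C y) * C Polynomial.X * (X * (1 - C Polynomial.X) +
        (1 - X * C Polynomial.X) * PowerSeries.map Polynomial.C (g y 1 1)) := by
  have hE := one_sub_mul_g (Polynomial.C y) Polynomial.X 1
  have hA := one_sub_mul_avoidersSeries (Polynomial.C y) Polynomial.X
  simp only [map_g, map_one] at hE ⊢
  linear_combination (1 - X * C Polynomial.X) * hE +
    (1 - C Polynomial.X) * X * C (Polynomial.C y) * hA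

section Kernel

variable {R : Type*} [CommRing R] [IsDomain R] {y : R} {U : R⟦X⟧}

/-- The hypothesis `hU` says D(U) = 0, so the right-hand side of `kernel_equation` vanishes at T =
U. This is a linear equation for g(1, 1). -/
theorem C_mul_g_one_one (hy : y ≠ 0) (hU : X * U ^ 2 - (1 + X - X * C y) * U + 1 = 0)
    (hU0 : constantCoeff U = 1) : C y * g y 1 1 = (1 - X) * (U - 1) - X * C y := by
  have hK := kernel_equation y
  have hU' := congrArg (PowerSeries.map Polynomial.C) hU
  simp only [map_add, map_sub, map_mul, map_pow, map_one, map_zero, map_X, map_C] at hU'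
  have hr : X * C y * U * (X * (1 - U) + (1 - X * U) * g y 1 1) = 0 := by
    -- The witness is a divided difference: D(T) = (T - U)(x(T + U) - (1 + x - xy)), and the
    -- right-hand side minus its value at U is likewise divided by T - U.
    refine eq_zero_of_sub_mul_eq (s := U) hU0 (f := (1 - X) * (X * (C Polynomial.X +
      PowerSeries.map Polynomial.C U) - (1 + X - X * C (Polynomial.C y))) *
        g (Polynomial.C y) Polynomial.X 1 - X * C (Polynomial.C y) *
        (X - X * (C Polynomial.X + PowerSeries.map Polynomial.C U) +
          PowerSeries.map Polynomial.C (g y 1 1) *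
          (1 - X * (C Polynomial.X + PowerSeries.map Polynomial.C U)))) ?_
    simp only [map_add, map_sub, map_mul, map_one, map_X, map_C]
    linear_combination hK - (1 - X) * g (Polynomial.C y) Polynomial.X 1 * hU'
  have hC : (C y : R⟦X⟧) ≠ 0 := (map_ne_zero_iff _ C_injective).2 hy
  have hQ := (mul_eq_zero.1 hr).resolve_left
    (mul_ne_zero (mul_ne_zero X_ne_zero hC) (ne_zero_of_constantCoeff_eq_one hU0))
  have h1 : (1 - X * U) ≠ 0 := ne_zero_of_constantCoeff_eq_one (by simp)
  refine mul_left_cancel₀ h1 ?_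
  linear_combination C y * hQ + (1 - X) * hU

theorem kernel_mul_g_fwd_X (hy : y ≠ 0) (hU : X * U ^ 2 - (1 + X - X * C y) * U + 1 = 0)
    (hU0 : constantCoeff U = 1) :
    ((1 - C Polynomial.X) * (1 - X * C Polynomial.X) +
        X * C (Polynomial.C y) * C Polynomial.X) * g (Polynomial.C y) Polynomial.X 1 =
      C Polynomial.X * X * (1 - C Polynomial.X * X) * (PowerSeries.map Polynomial.C U - 1) -
        C Polynomial.X ^ 2 * X ^ 2 * C (Polynomial.C y) := by
  have hK := kernel_equation y
  have hh := congrArg (PowerSeries.map Polynomial.C) (C_mul_g_one_one hy hU hU0)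
  simp only [map_sub, map_mul, map_one, map_X, map_C] at hh
  have h1 : (1 - X : (Polynomial R)⟦X⟧) ≠ 0 := ne_zero_of_constantCoeff_eq_one (by simp)
  refine mul_left_cancel₀ h1 ?_
  linear_combination hK + X * C Polynomial.X * (1 - X * C Polynomial.X) * hh

theorem kernel_mul_g_fwd (hy : y ≠ 0) (hU : X * U ^ 2 - (1 + X - X * C y) * U + 1 = 0)
    (hU0 : constantCoeff U = 1) (v : R) :
    ((1 - C v) * (1 - X * C v) + X * C y * C v) * g y v 1 =
      C v * X * (1 - C v * X) * (U - 1) - C v ^ 2 * X ^ 2 * C y := by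
  have h := congrArg (PowerSeries.map (Polynomial.evalRingHom v)) (kernel_mul_g_fwd_X hy hU hU0)
  have hUU : PowerSeries.map (Polynomial.evalRingHom v) (PowerSeries.map Polynomial.C U) = U := by
    ext n
    simp
  simpa [map_g, hUU] using h

/-- With A(T) known from the case v = 1, the only unknowns are g(T, v) and g(1, v). The kernel (1 -
T)(1 - xv) + xyv is linear in T, and its root s eliminates g(T, v). -/
theorem kernel_mul_g_zeros (hy : y ≠ 0) (hU : X * U ^ 2 - (1 + X - X * C y) * U + 1 = 0)
    (hU0 : constantCoeff U = 1) {v : R} (hv : v ≠ 0) :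
    ((1 - C v) * (1 - X * C v) + X * C y * C v) * g y 1 v =
      C v * X * (1 - C v * X) * (U - 1) - C v ^ 2 * X ^ 2 * C y := by
  have hU' := congrArg (PowerSeries.map Polynomial.C) hU
  simp only [map_add, map_sub, map_mul, map_pow, map_one, map_zero, map_X, map_C] at hU'
  obtain ⟨s, hs, hs0⟩ : ∃ s : R⟦X⟧, (1 - X * C v) * (1 - s) + X * C y * C v = 0 ∧
      constantCoeff s = 1 := by
    have hunit : IsUnit (1 - X * C v : R⟦X⟧) := isUnit_iff_constantCoeff.2 (by simp)
    obtain ⟨w, hw⟩ := hunit.exists_right_inv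
    refine ⟨1 + X * C y * C v * w, ?_, by simp⟩
    linear_combination -(X * C y * C v) * hw
  have hs' := congrArg (PowerSeries.map Polynomial.C) hs
  simp only [map_add, map_sub, map_mul, map_one, map_zero, map_X, map_C] at hs'
  have hG := kernel_mul_g_fwd_X hy hU hU0
  have hE := one_sub_mul_g (Polynomial.C y) Polynomial.X (Polynomial.C v)
  have hA := one_sub_mul_avoidersSeries (Polynomial.C y) Polynomial.X
  have hF : g (Polynomial.C y) 1 (Polynomial.C v) = PowerSeries.map Polynomial.C (g y 1 v) := by
    simp [map_g]
  rw [hF] at hE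
  have h1 : (1 - X * C Polynomial.X : (Polynomial R)⟦X⟧) ≠ 0 :=
    ne_zero_of_constantCoeff_eq_one (by simp)
  have hTU : (C Polynomial.X - PowerSeries.map Polynomial.C U : (Polynomial R)⟦X⟧) ≠ 0 := by
    intro h0
    have := congrArg constantCoeff h0
    rw [map_sub, constantCoeff_C, ← coeff_zero_eq_constantCoeff_apply (PowerSeries.map _ U),
      coeff_map, coeff_zero_eq_constantCoeff_apply, hU0, map_zero] at this
    exact Polynomial.X_sub_C_ne_zero 1 this
  -- By `hG` and `hA`, D(T)(A(T) - 1) = xT(U - T). Multiplying the functional equation by D(T)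
  -- therefore allows T - U to be cancelled, and D(T) leaves only its other factor x(T + U) - (1 + x
  -- - xy).
  have hG2 : (X * (C Polynomial.X + PowerSeries.map Polynomial.C U) -
        (1 + X - X * C (Polynomial.C y))) * ((1 - C Polynomial.X) * (1 - X * C (Polynomial.C v)) +
        X * C (Polynomial.C y) * C (Polynomial.C v)) *
          g (Polynomial.C y) Polynomial.X (Polynomial.C v) =
      X * C (Polynomial.C y) * C (Polynomial.C v) * C Polynomial.X *
        (-X * (1 - C Polynomial.X) + (X * (C Polynomial.X + PowerSeries.map Polynomial.C U) -
        (1 + X - X * C (Polynomial.C y))) * PowerSeries.map Polynomial.C (g y 1 v)) := by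
    refine mul_left_cancel₀ h1 (mul_left_cancel₀ hTU ?_)
    set T : (Polynomial R)⟦X⟧ := C Polynomial.X
    set V : (Polynomial R)⟦X⟧ := C (Polynomial.C v)
    set Y : (Polynomial R)⟦X⟧ := C (Polynomial.C y)
    set W := PowerSeries.map Polynomial.C U
    set F := PowerSeries.map Polynomial.C (g y 1 v)
    set G := g (Polynomial.C y) Polynomial.X (Polynomial.C v)
    have hD : (T - W) * (X * (T + W) - (1 + X - X * Y)) =
        (1 - T) * (1 - X * T) + X * Y * T := by
      linear_combination -hU'
    have hD2 : ((1 - T) * (1 - X * V) + X * Y * V) * G =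
        X * Y * V * ((1 - T) * (avoidersSeries (Polynomial.C y) Polynomial.X - 1) + T * F) := by
      linear_combination hE
    calc _ = (1 - X * T) * ((T - W) * (X * (T + W) - (1 + X - X * Y))) *
            (((1 - T) * (1 - X * V) + X * Y * V) * G) := by ring
      _ = X * Y * V * (1 - X * T) * T * (-X * (1 - T) * (T - W) +
            ((T - W) * (X * (T + W) - (1 + X - X * Y))) * F) := by
        rw [hD, hD2]
        linear_combination X * Y * V * (1 - T) * ((1 - T) * (1 - X * T) + X * Y * T) * hA +
          X * Y * V * (1 - T) * hG
      _ = _ := by ring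
  have hp : X * C y * C v * s * (-X * (1 - s) + (X * (s + U) - (1 + X - X * C y)) * g y 1 v)
      = 0 := by
    -- Again a divided difference: by `hs'` the linear kernel equals -(1 - xv)(T - s).
    refine eq_zero_of_sub_mul_eq hs0 (f := -(1 - X * C (Polynomial.C v)) *
      (X * (C Polynomial.X + PowerSeries.map Polynomial.C U) -
        (1 + X - X * C (Polynomial.C y))) * g (Polynomial.C y) Polynomial.X (Polynomial.C v) -
      X * C (Polynomial.C y) * C (Polynomial.C v) *
        (-X + (X + X * PowerSeries.map Polynomial.C (g y 1 v)) *
          (C Polynomial.X + PowerSeries.map Polynomial.C s) +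
          (X * PowerSeries.map Polynomial.C U - (1 + X - X * C (Polynomial.C y))) *
          PowerSeries.map Polynomial.C (g y 1 v))) ?_
    simp only [map_add, map_sub, map_mul, map_neg, map_one, map_X, map_C]
    linear_combination hG2 - (X * (C Polynomial.X + PowerSeries.map Polynomial.C U) -
        (1 + X - X * C (Polynomial.C y))) *
          g (Polynomial.C y) Polynomial.X (Polynomial.C v) * hs'
  have hC : ∀ a : R, a ≠ 0 → (C a : R⟦X⟧) ≠ 0 := fun a ha => (map_ne_zero_iff _ C_injective).2 ha
  have hq := (mul_eq_zero.1 hp).resolve_left (mul_ne_zero (mul_ne_zero (mul_ne_zero X_ne_zero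
    (hC y hy)) (hC v hv)) (ne_zero_of_constantCoeff_eq_one hs0))
  -- Eliminating s gives g(1, v) as a quotient with a different denominator; the quadratic for U
  -- then converts it to the denominator D(v).
  have hk : g y 1 v * ((1 - X * C v) * (1 - X * C y - X * U) - X ^ 2 * C y * C v) =
      X ^ 2 * C y * C v := by
    linear_combination -(1 - X * C v) * hq - X * (1 + g y 1 v) * hs
  have hk0 : (1 - X * C v) * (1 - X * C y - X * U) - X ^ 2 * C y * C v ≠ 0 :=
    ne_zero_of_constantCoeff_eq_one (by simp)
  refine mul_left_cancel₀ hk0 ?_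
  linear_combination ((1 - C v) * (1 - X * C v) + X * C y * C v) * hk +
    X * C v * (1 - X * C v) ^ 2 * hU

end Kernel
-- The kernel root over ℚ[y, u] and its relation to κ
theorem psqrt_disc_sq : psqrt disc ^ 2 = disc := psqrt_sq constantCoeff_disc

theorem two_mul_C_C_half : (2 : Coef⟦X⟧) * C (MvPolynomial.C (1 / 2)) = 1 := by
  have h : (2 : Coef⟦X⟧) = C (MvPolynomial.C 2) :=
    (map_ofNat ((C : Coef →+* Coef⟦X⟧).comp MvPolynomial.C) 2).symm
  rw [h, ← map_mul, ← map_mul]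
  norm_num

theorem two_ne_zero_powerSeries : (2 : Coef⟦X⟧) ≠ 0 :=
  left_ne_zero_of_mul_eq_one two_mul_C_C_half

/-- The discriminant (1 + x - xy)² - 4x of the kernel equals `disc`. With the minus sign the
numerator has constant term 0, so division by 2x stays within power series. -/
theorem exists_kernel_root : ∃ U : Coef⟦X⟧, 2 * X * U = 1 + X - X * C yv - psqrt disc ∧
    X * U ^ 2 - (1 + X - X * C yv) * U + 1 = 0 ∧ constantCoeff U = 1 := by
  obtain ⟨W, hW⟩ : X ∣ 1 + X - X * C yv - psqrt disc :=
    X_dvd_iff.2 (by simp [constantCoeff_psqrt constantCoeff_disc])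
  have h2 := two_mul_C_C_half
  have hU : 2 * X * (C (MvPolynomial.C (1 / 2)) * W) = 1 + X - X * C yv - psqrt disc := by
    rw [hW]
    linear_combination X * W * h2
  generalize C (MvPolynomial.C (1 / 2)) * W = U at hU
  have hquad : X * U ^ 2 - (1 + X - X * C yv) * U + 1 = 0 := by
    have hs := psqrt_disc_sq
    have h4 : (2 * 2 * X : Coef⟦X⟧) ≠ 0 :=
      mul_ne_zero (mul_ne_zero two_ne_zero_powerSeries two_ne_zero_powerSeries) X_ne_zero
    refine mul_left_cancel₀ h4 ?_
    have hq : psqrt disc = 1 + X - X * C yv - 2 * X * U := by linear_combination hU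
    rw [hq, disc] at hs
    linear_combination hs
  refine ⟨U, hU, hquad, ?_⟩
  have := congrArg constantCoeff hquad
  simp at this
  linear_combination -this

theorem toL_injective : Function.Injective toL := IsFractionRing.injective Coef⟦X⟧ L

theorem yv_ne_zero : yv ≠ 0 := MvPolynomial.X_ne_zero 0

theorem uv_ne_zero : uv ≠ 0 := MvPolynomial.X_ne_zero 1

theorem uv_ne_one : uv ≠ 1 := fun h => by
  simpa [uv] using congrArg (MvPolynomial.eval 0) h

theorem denominator_ne_zero :
    ((1 - C uv) * (1 - X * C uv) + X * C yv * C uv : Coef⟦X⟧) ≠ 0 := fun h => by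
  have := congrArg constantCoeff h
  simp [sub_eq_zero] at this
  exact uv_ne_one this.symm

theorem κ_eq {U : Coef⟦X⟧} (hU : 2 * X * U = 1 + X - X * C yv - psqrt disc) :
    y * κ = toL U - 1 := by
  have h := congrArg toL hU
  simp only [map_mul, map_add, map_sub, map_one, map_ofNat] at h
  have hx : x ≠ 0 := (map_ne_zero_iff _ toL_injective).2 X_ne_zero
  have hy : y ≠ 0 := (map_ne_zero_iff _ toL_injective).2
    ((map_ne_zero_iff _ C_injective).2 yv_ne_zero)
  have h2 : (2 : L) ≠ 0 := by
    rw [← map_ofNat toL 2]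
    exact (map_ne_zero_iff _ toL_injective).2 two_ne_zero_powerSeries
  rw [κ, mul_div_assoc', div_eq_iff (by simp [hx, hy, h2])]
  change 2 * x * toL U = 1 + x - x * y - toL (psqrt disc) at h
  linear_combination -y * h

end AscentSeq

theorem theorem1 :
    AscentSeq.g AscentSeq.yv AscentSeq.uv 1 = AscentSeq.g AscentSeq.yv 1 AscentSeq.uv ∧
    AscentSeq.toL (AscentSeq.g AscentSeq.yv AscentSeq.uv 1) =
      (AscentSeq.u * AscentSeq.x * AscentSeq.y * (1 - AscentSeq.u * AscentSeq.x) * AscentSeq.κ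
          - AscentSeq.u ^ 2 * AscentSeq.x ^ 2 * AscentSeq.y) /
        ((1 - AscentSeq.u) * (1 - AscentSeq.u * AscentSeq.x)
          + AscentSeq.u * AscentSeq.x * AscentSeq.y) := by
  open AscentSeq in
  obtain ⟨U, hU, hquad, hU0⟩ := exists_kernel_root
  have h1 := kernel_mul_g_fwd yv_ne_zero hquad hU0 uv
  have h2 := kernel_mul_g_zeros yv_ne_zero hquad hU0 uv_ne_zero
  -- D(u) has constant coefficient 1 - u ≠ 0, so it cancels.
  refine ⟨mul_left_cancel₀ denominator_ne_zero (h1.trans h2.symm), ?_⟩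
  have hD := (map_ne_zero_iff _ toL_injective).2 denominator_ne_zero
  have h := congrArg toL h1
  simp only [map_mul, map_add, map_sub, map_one, map_pow] at h hD
  change (1 - u) * (1 - x * u) + x * y * u ≠ 0 at hD
  change ((1 - u) * (1 - x * u) + x * y * u) * _ =
    u * x * (1 - u * x) * (toL U - 1) - u ^ 2 * x ^ 2 * y at h
  rw [eq_div_iff (by convert hD using 1; ring)]
  linear_combination h - u * x * (1 - u * x) * κ_eq hU
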